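/- Let $\Sigma$ be a finite nonempty set and let $P=(P_{ij})_{i,j\in\Sigma}$ be a (row-)stochastic matrix. Assume that $P$ is irreducible and periodic with period $2$; that is, for every $i\in\Sigma$ the greatest common divisor of $\{n\ge 1:(P^n)_{ii}>0\}$ is $2$. Then $P$ has a unique stationary distribution $\pi$ (a probability row vector with $\pi P=\pi$), and the following strong law of large numbers holds. Let $w$ be any real-valued function on $\Sigma\times\Sigma$, let $W:=(w(i,j))_{i,j\in\Sigma}$ be the payoff matrix, and put $$\mu:=\pi\dot P\mathbf 1,$$ where $\dot P:=P\circ W$ is the Hadamard (entrywise) product and $\mathbf 1$ is the column vector of ones indexed by $\Sigma$. Let $\{X_n\}_{n\ge0}$ be a Markov chain in $\Sigma$ with transition matrix $P$ and arbitrary initial distribution, and let $S_n:=\sum_{k=1}^n w(X_{k-1},X_k)$ for $n\ge1$. Then $$\lim_{n\to\infty}n^{-1}S_n=\mu\quad\text{a.s.}$$ -/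

import Mathlib

open MeasureTheory Filter Topology
open scoped Matrix

noncomputable section

namespace FiniteMarkov

variable {S : Type*} [Fintype S] [DecidableEq S]

/-- Every state of the chain with transition matrix `P` has period `d`: for each state `i`, the
number `d` is the greatest common divisor of the set of `n ≥ 1` with `(P ^ n) i i > 0`. -/
def HasPeriod (P : Matrix S S ℝ) (d : ℕ) : Prop :=
  ∀ i : S, (∀ n : ℕ, 1 ≤ n → 0 < (P ^ n) i i → d ∣ n) ∧
    ∀ c : ℕ, (∀ n : ℕ, 1 ≤ n → 0 < (P ^ n) i i → c ∣ n) → c ∣ d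

/-- The row vector `π` is a probability vector with `π P = π`. -/
def IsStationary (P : Matrix S S ℝ) (π : S → ℝ) : Prop :=
  π ∈ stdSimplex ℝ S ∧ π ᵥ* P = π

/-- `X 0, X 1, …` is a Markov chain with transition matrix `P`, on the probability space
`(Ω, μ)`. The second field is the Markov property
`μ (X (n + 1) = x (n + 1) | X 0 = x 0, …, X n = x n) = P (x n) (x (n + 1))`, multiplied out so that
it is also meaningful (and trivially true) when the conditioning event is null. Nothing is required
of the distribution of `X 0`: the initial distribution is arbitrary. -/
structure IsMarkovChain {Ω : Type*} [MeasurableSpace Ω] [MeasurableSpace S]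
    (P : Matrix S S ℝ) (μ : Measure Ω) (X : ℕ → Ω → S) : Prop where
  measurable : ∀ n, Measurable (X n)
  markov : ∀ (n : ℕ) (x : ℕ → S),
    μ.real {ω | ∀ k ≤ n + 1, X k ω = x k} =
      μ.real {ω | ∀ k ≤ n, X k ω = x k} * P (x n) (x (n + 1))

/-- The cumulative payoff `S_n = w(X_0, X_1) + ⋯ + w(X_{n-1}, X_n)`, where the payoff function `w`
is given by the payoff matrix `W`. -/
def cumulativePayoff {Ω : Type*} (W : Matrix S S ℝ) (X : ℕ → Ω → S) (n : ℕ) (ω : Ω) : ℝ :=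
  ∑ k ∈ Finset.range n, W (X k ω) (X (k + 1) ω)

/-- The mean payoff `π Ṗ 1`, where `Ṗ = P ∘ W` is the Hadamard (entrywise) product and `1` is the
column vector of ones. -/
def meanPayoff (P W : Matrix S S ℝ) (π : S → ℝ) : ℝ :=
  π ⬝ᵥ ((P ⊙ W) *ᵥ 1)

end FiniteMarkov

end

namespace FiniteMarkov

section Matrices

variable {S : Type*} [Fintype S] [DecidableEq S]

/-! With `f i` the mean payoff of one step from `i`, solve the Poisson equation `f - m = g - P g`,
where `m` is the stationary mean of `f`. Then `W i j - m + g j - g i` has conditional mean zero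
given `i`. So `S_n - n m` is a sum of bounded, pairwise orthogonal increments minus `g (X n) - g (X
0)`, which stays bounded. Orthogonality makes the second moment of that sum grow at most linearly,
and this gives almost sure convergence of the averages to zero. -/

/-- The maximum principle: a harmonic function of an irreducible stochastic matrix is constant. -/
theorem eq_of_mulVec_eq_self {P : Matrix S S ℝ} (hP : P ∈ Matrix.rowStochastic ℝ S)
    (hirr : P.IsIrreducible) {g : S → ℝ} (hg : P *ᵥ g = g) (i j : S) : g i = g j := by
  have : Nonempty S := ⟨i⟩
  obtain ⟨m, hm⟩ := Finite.exists_max g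
  have key : ∀ j, g j = g m := by
    intro j
    obtain ⟨k, -, hk⟩ := (Matrix.isIrreducible_iff_exists_pow_pos hP.1).1 hirr m j
    have hPk := pow_mem hP k
    have hgk : (P ^ k) *ᵥ g = g := by
      clear hk hPk
      induction k with
      | zero => simp
      | succ k ih => rw [pow_succ, ← Matrix.mulVec_mulVec, hg, ih]
    -- `g m` is a `P ^ k`-average of values at most `g m`, so every state of positive weight attains
    -- it.
    have hsum : ∑ l, (P ^ k) m l * (g m - g l) = 0 := by
      have h1 : ∑ l, (P ^ k) m l * g l = g m := congrFun hgk m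
      simp only [mul_sub, Finset.sum_sub_distrib, ← Finset.sum_mul,
        Matrix.sum_row_of_mem_rowStochastic hPk, h1]
      ring
    have h0 := (Finset.sum_eq_zero_iff_of_nonneg
      (fun l _ => mul_nonneg (hPk.1 m l) (sub_nonneg.2 (hm l)))).1 hsum j (Finset.mem_univ j)
    rcases mul_eq_zero.1 h0 with h | h
    · exact absurd h hk.ne'
    · linarith
  rw [key i, key j]

/-- Since `P` fixes `1`, it has a nonzero left fixed vector `v`. The triangle inequality gives `|v|
≤ |v| P`; both sides have equal total mass, so equality holds and `|v|` can be normalised. -/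
theorem exists_isStationary [Nonempty S] {P : Matrix S S ℝ}
    (hP : P ∈ Matrix.rowStochastic ℝ S) : ∃ π : S → ℝ, IsStationary P π := by
  have hdet : (P - 1).det = 0 :=
    Matrix.exists_mulVec_eq_zero_iff.1 ⟨1, one_ne_zero, by
      rw [Matrix.sub_mulVec, hP.2, Matrix.one_mulVec, sub_self]⟩
  obtain ⟨v, hv0, hv⟩ := Matrix.exists_vecMul_eq_zero_iff.2 hdet
  rw [Matrix.vecMul_sub, Matrix.vecMul_one, sub_eq_zero] at hv
  set a : S → ℝ := fun i => |v i| with ha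
  have hle : ∀ j, a j ≤ (a ᵥ* P) j := by
    intro j
    calc a j = |∑ i, v i * P i j| := by
          simp only [ha]; rw [← congrFun hv j]; rfl
      _ ≤ ∑ i, |v i * P i j| := Finset.abs_sum_le_sum_abs _ _
      _ = (a ᵥ* P) j := by
          simp only [Matrix.vecMul, dotProduct, ha, abs_mul, abs_of_nonneg (hP.1 _ _)]
  have hsum : ∑ j, a j = ∑ j, (a ᵥ* P) j := by
    simp only [Matrix.vecMul, dotProduct]
    rw [Finset.sum_comm]
    simp only [← Finset.mul_sum, Matrix.sum_row_of_mem_rowStochastic hP, mul_one]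
  have haP : a ᵥ* P = a := by
    funext j
    exact ((Finset.sum_eq_sum_iff_of_le fun j _ => hle j).1 hsum j (Finset.mem_univ j)).symm
  have hpos : 0 < ∑ j, a j := by
    obtain ⟨i, hi⟩ := Function.ne_iff.1 hv0
    exact Finset.sum_pos' (fun j _ => abs_nonneg _) ⟨i, Finset.mem_univ i, abs_pos.2 hi⟩
  refine ⟨(∑ j, a j)⁻¹ • a, ⟨fun i => ?_, ?_⟩, ?_⟩
  · exact mul_nonneg (inv_nonneg.2 hpos.le) (abs_nonneg _)
  · simp only [Pi.smul_apply, smul_eq_mul, ← Finset.mul_sum]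
    exact inv_mul_cancel₀ hpos.ne'
  · rw [Matrix.smul_vecMul, haP]

/-- The Poisson equation: every function is, up to its stationary mean, of the form `g - P g`. -/
theorem exists_poisson_solution {P : Matrix S S ℝ} (hP : P ∈ Matrix.rowStochastic ℝ S)
    (hirr : P.IsIrreducible) {π : S → ℝ} (hπ : IsStationary P π) (f : S → ℝ) :
    ∃ g : S → ℝ, ∀ i, f i - π ⬝ᵥ f = g i - (P *ᵥ g) i := by
  have hπ1 : π ⬝ᵥ (1 : S → ℝ) = 1 := by
    rw [dotProduct_one]; exact hπ.1.2
  -- The rank-one term repairs the kernel of `1 - P`, which is the constants; since `T` preserves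
  -- the `π`-mean, `T g = f` is the Poisson equation.
  let T : (S → ℝ) →ₗ[ℝ] (S → ℝ) :=
    { toFun := fun g => g - P *ᵥ g + (π ⬝ᵥ g) • (1 : S → ℝ)
      map_add' := fun x y => by
        rw [Matrix.mulVec_add, dotProduct_add, add_smul]; abel
      map_smul' := fun c x => by
        simp only [Matrix.mulVec_smul, dotProduct_smul, smul_add, smul_sub, smul_smul,
          smul_eq_mul, RingHom.id_apply] }
  have hT : ∀ g, T g = g - P *ᵥ g + (π ⬝ᵥ g) • (1 : S → ℝ) := fun _ => rfl
  have hπT : ∀ g, π ⬝ᵥ T g = π ⬝ᵥ g := by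
    intro g
    rw [hT, dotProduct_add, dotProduct_sub, Matrix.dotProduct_mulVec, hπ.2, dotProduct_smul, hπ1]
    simp
  have hinj : Function.Injective T := by
    refine (injective_iff_map_eq_zero T).2 fun g hg => ?_
    have h0 : π ⬝ᵥ g = 0 := by rw [← hπT, hg, dotProduct_zero]
    have h1 : P *ᵥ g = g := by
      rw [hT, h0, zero_smul, add_zero, sub_eq_zero] at hg
      exact hg.symm
    funext i
    have hc : g = g i • (1 : S → ℝ) := by
      funext j
      simp [eq_of_mulVec_eq_self hP hirr h1 j i]
    rw [hc, dotProduct_smul, hπ1] at h0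
    simpa using h0
  obtain ⟨g, hg⟩ := LinearMap.injective_iff_surjective.1 hinj f
  refine ⟨g, fun i => ?_⟩
  rw [← hg, hπT, hT]
  simp

/-- Any stationary `ρ` annihilates `g - P g`, so it agrees with `π` on every function, in particular
on indicators. -/
theorem IsStationary.unique {P : Matrix S S ℝ} (hP : P ∈ Matrix.rowStochastic ℝ S)
    (hirr : P.IsIrreducible) {π ρ : S → ℝ} (hπ : IsStationary P π) (hρ : IsStationary P ρ) :
    ρ = π := by
  funext i
  obtain ⟨g, hg⟩ := exists_poisson_solution hP hirr hπ (Pi.single i 1)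
  have hρ1 : ρ ⬝ᵥ (1 : S → ℝ) = 1 := by
    rw [dotProduct_one]; exact hρ.1.2
  have hfun : (Pi.single i 1 : S → ℝ) - π i • (1 : S → ℝ) = g - P *ᵥ g := by
    funext j
    simpa using hg j
  have h := congrArg (fun f => ρ ⬝ᵥ f) hfun
  simp only [dotProduct_sub, dotProduct_smul, hρ1, Matrix.dotProduct_mulVec, hρ.2] at h
  simp at h
  linarith

end Matrices

/-! ### A strong law from second moments -/

section Probability

variable {Ω : Type*} [MeasurableSpace Ω] {μ : Measure Ω}

theorem ae_tendsto_zero_of_summable_integral {Y : ℕ → Ω → ℝ} (hY : ∀ n ω, 0 ≤ Y n ω)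
    (hint : ∀ n, Integrable (Y n) μ) (hsum : Summable fun n => ∫ ω, Y n ω ∂μ) :
    ∀ᵐ ω ∂μ, Tendsto (fun n => Y n ω) atTop (𝓝 0) := by
  have hmeas : ∀ n, AEMeasurable (fun ω => ENNReal.ofReal (Y n ω)) μ :=
    fun n => (hint n).aemeasurable.ennreal_ofReal
  have hfin : ∫⁻ ω, ∑' n, ENNReal.ofReal (Y n ω) ∂μ ≠ ⊤ := by
    rw [lintegral_tsum hmeas]
    simp only [← ofReal_integral_eq_lintegral_ofReal (hint _) (Eventually.of_forall (hY _))]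
    exact hsum.tsum_ofReal_ne_top
  filter_upwards [ae_lt_top' (AEMeasurable.tsum hmeas) hfin] with ω hω
  have h := ENNReal.tendsto_atTop_zero_of_tsum_ne_top hω.ne
  have h' := (ENNReal.tendsto_toReal ENNReal.zero_ne_top).comp h
  simpa [Function.comp_def, ENNReal.toReal_ofReal (hY _ _)] using h'

/-- The strong law of large numbers for bounded, pairwise orthogonal random variables. -/
theorem ae_tendsto_average_zero_of_orthogonal [IsProbabilityMeasure μ] {d : ℕ → Ω → ℝ} {C : ℝ}
    (hmeas : ∀ n, Measurable (d n)) (hbdd : ∀ n ω, |d n ω| ≤ C)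
    (horth : ∀ m n, m < n → ∫ ω, d m ω * d n ω ∂μ = 0) :
    ∀ᵐ ω ∂μ, Tendsto (fun n : ℕ => (∑ k ∈ Finset.range n, d k ω) / n) atTop (𝓝 0) := by
  have hintmul : ∀ m n, Integrable (fun ω => d m ω * d n ω) μ := fun m n =>
    Integrable.of_bound ((hmeas m).mul (hmeas n)).aestronglyMeasurable (C * C)
      (Eventually.of_forall fun ω => by
        rw [Real.norm_eq_abs, abs_mul]
        exact mul_le_mul (hbdd m ω) (hbdd n ω) (abs_nonneg _) ((abs_nonneg _).trans (hbdd m ω)))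
  have hsq : ∀ n ω, (∑ k ∈ Finset.range n, d k ω) ^ 2 =
      ∑ i ∈ Finset.range n, ∑ j ∈ Finset.range n, d i ω * d j ω := by
    intro n ω
    rw [sq, Finset.sum_mul_sum]
  have hintsq : ∀ n, Integrable (fun ω => (∑ k ∈ Finset.range n, d k ω) ^ 2) μ := by
    intro n
    simp only [hsq]
    exact integrable_finsetSum _ fun i _ => integrable_finsetSum _ fun j _ => hintmul i j
  have hvar : ∀ n : ℕ, ∫ ω, (∑ k ∈ Finset.range n, d k ω) ^ 2 ∂μ ≤ n * (C * C) := by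
    intro n
    simp only [hsq]
    rw [integral_finsetSum _ fun i _ => integrable_finsetSum _ fun j _ => hintmul i j]
    calc ∑ i ∈ Finset.range n, ∫ ω, ∑ j ∈ Finset.range n, d i ω * d j ω ∂μ
        ≤ ∑ i ∈ Finset.range n, C * C := by
          refine Finset.sum_le_sum fun i hi => ?_
          rw [integral_finsetSum _ fun j _ => hintmul i j, Finset.sum_eq_single_of_mem i hi]
          · calc ∫ ω, d i ω * d i ω ∂μ ≤ ∫ _, C * C ∂μ := by
                  refine integral_mono (hintmul i i) (integrable_const _) fun ω => ?_
                  have h := mul_le_mul (hbdd i ω) (hbdd i ω) (abs_nonneg _)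
                    ((abs_nonneg _).trans (hbdd i ω))
                  rwa [abs_mul_abs_self] at h
              _ = C * C := by simp
          · intro j _ hji
            rcases lt_or_gt_of_ne hji with h | h
            · simp only [mul_comm (d i _)]
              exact horth j i h
            · exact horth i j h
      _ = n * (C * C) := by simp
  -- Along squares the second moments of the averages are at most `C² / n²`, hence summable.
  have hsub : ∀ᵐ ω ∂μ, Tendsto (fun n : ℕ =>
      ((∑ k ∈ Finset.range (n ^ 2), d k ω) / ((n ^ 2 : ℕ) : ℝ)) ^ 2) atTop (𝓝 0) := by
    refine ae_tendsto_zero_of_summable_integral (fun n ω => sq_nonneg _) (fun n => ?_) ?_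
    · simp only [div_pow]
      exact (hintsq _).div_const _
    · refine Summable.of_nonneg_of_le (fun n => integral_nonneg fun ω => sq_nonneg _) (fun n => ?_)
        ((Real.summable_one_div_nat_pow.2 one_lt_two).mul_left (C * C))
      simp only [div_pow]
      rw [integral_div]
      rcases Nat.eq_zero_or_pos n with rfl | hn
      · simp
      have hn' : (0 : ℝ) < n := Nat.cast_pos.2 hn
      calc (∫ ω, (∑ k ∈ Finset.range (n ^ 2), d k ω) ^ 2 ∂μ) / ((n ^ 2 : ℕ) : ℝ) ^ 2
          ≤ ((n ^ 2 : ℕ) * (C * C)) / ((n ^ 2 : ℕ) : ℝ) ^ 2 := by gcongr; exact hvar _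
        _ = C * C * (1 / (n : ℝ) ^ 2) := by push_cast; field_simp
  filter_upwards [hsub] with ω hω
  have hω' : Tendsto (fun n : ℕ =>
      (∑ k ∈ Finset.range (n ^ 2), d k ω) / ((n ^ 2 : ℕ) : ℝ)) atTop (𝓝 0) := by
    refine (tendsto_zero_iff_abs_tendsto_zero _).2 ?_
    have h := hω.sqrt
    simpa only [Real.sqrt_sq_eq_abs, Real.sqrt_zero, Function.comp_def] using h
  -- Adding `C * n` makes the partial sums monotone, so that a subsequence controls the rest.
  have hcancel : ∀ n : ℕ, n ≠ 0 → (∑ k ∈ Finset.range n, d k ω + C * n) / n =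
      (∑ k ∈ Finset.range n, d k ω) / n + C := by
    intro n hn
    have : (n : ℝ) ≠ 0 := Nat.cast_ne_zero.2 hn
    field_simp
  have hmono : Tendsto (fun n : ℕ => (∑ k ∈ Finset.range n, d k ω + C * n) / n) atTop (𝓝 C) := by
    refine tendsto_div_of_monotone_of_exists_subseq_tendsto_div _ C ?_ ?_
    · refine monotone_nat_of_le_succ fun n => ?_
      rw [Finset.sum_range_succ]
      push_cast
      linarith [(abs_le.1 (hbdd n ω)).1]
    · intro a ha
      refine ⟨fun n => n ^ 2, ?_, tendsto_pow_atTop two_ne_zero, ?_⟩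
      -- `(n + 1)² ≤ n² + 3 n ≤ a n²` once `n ≥ 1` and `3 ≤ (a - 1) n`.
      · filter_upwards [eventually_ge_atTop 1, eventually_ge_atTop ⌈3 / (a - 1)⌉₊] with n hn1 hn
        have h3 : 3 / (a - 1) ≤ n := Nat.ceil_le.1 hn
        rw [div_le_iff₀ (by linarith)] at h3
        have hn1' : (1 : ℝ) ≤ n := by exact_mod_cast hn1
        push_cast
        nlinarith
      · have h := hω'.add_const C
        rw [zero_add] at h
        refine h.congr' ?_
        filter_upwards [eventually_ne_atTop 0] with n hn
        exact (hcancel (n ^ 2) (pow_ne_zero 2 hn)).symm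
  have h := hmono.sub_const C
  rw [sub_self] at h
  refine h.congr' ?_
  filter_upwards [eventually_ne_atTop 0] with n hn
  rw [hcancel n hn, add_sub_cancel_right]

end Probability

/-! ### Orthogonal increments along the chain -/

section Chain

variable {S : Type*} [Fintype S] [DecidableEq S] [MeasurableSpace S] [MeasurableSingletonClass S]
  {Ω : Type*} [MeasurableSpace Ω] {μ : Measure Ω} [IsProbabilityMeasure μ]
  {P : Matrix S S ℝ} {X : ℕ → Ω → S}

/-- A function of a transition with vanishing conditional mean is orthogonal to every function of
the past. -/
theorem IsMarkovChain.integral_mul_eq_zero (hX : IsMarkovChain P μ X) {h : S → S → ℝ}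
    (hh : ∀ i, ∑ j, P i j * h i j = 0) (n : ℕ) (G : (Fin (n + 1) → S) → ℝ) :
    ∫ ω, G (fun k => X k ω) * h (X n ω) (X (n + 1) ω) ∂μ = 0 := by
  -- `Z` has finitely many values, so the integral is a finite sum over histories; the Markov
  -- property factors each mass, and the sum over the next state vanishes.
  let Z : Ω → (Fin (n + 1) → S) × S := fun ω => (fun k => X k ω, X (n + 1) ω)
  have hZ : Measurable Z :=
    (measurable_pi_lambda (fun ω (k : Fin (n + 1)) => X k ω) fun k => hX.measurable k).prodMk
      (hX.measurable (n + 1))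
  let F : (Fin (n + 1) → S) × S → ℝ := fun z => G z.1 * h (z.1 (Fin.last n)) z.2
  have hmarkov : ∀ (x : Fin (n + 1) → S) (j : S), (μ.map Z).real {(x, j)} =
      μ.real {ω | ∀ k : Fin (n + 1), X k ω = x k} * P (x (Fin.last n)) j := by
    intro x j
    let y : ℕ → S := fun k => if hk : k < n + 1 then x ⟨k, hk⟩ else j
    have hy : ∀ k (hk : k < n + 1), y k = x ⟨k, hk⟩ := fun k hk => dif_pos hk
    have hyl : y (n + 1) = j := dif_neg (lt_irrefl _)
    have hset : {ω | ∀ k ≤ n, X k ω = y k} = {ω | ∀ k : Fin (n + 1), X k ω = x k} := by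
      ext ω
      refine ⟨fun H k => ?_, fun H k hk => ?_⟩
      · rw [H k (Nat.lt_succ_iff.1 k.2), hy k k.2]
      · rw [hy k (Nat.lt_succ_of_le hk)]
        exact H ⟨k, Nat.lt_succ_of_le hk⟩
    have hset' : {ω | ∀ k ≤ n + 1, X k ω = y k} = Z ⁻¹' {(x, j)} := by
      ext ω
      simp only [Set.mem_ofPred_eq, Set.mem_preimage, Set.mem_singleton_iff, Z, Prod.mk.injEq,
        funext_iff]
      refine ⟨fun H => ⟨fun k => ?_, ?_⟩, fun H k hk => ?_⟩
      · rw [H k k.2.le, hy k k.2]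
      · rw [H _ le_rfl, hyl]
      · rcases Nat.lt_or_eq_of_le hk with hk' | rfl
        · rw [hy k hk']
          exact H.1 ⟨k, hk'⟩
        · rw [hyl, H.2]
    have hm := hX.markov n y
    rw [hset, hset', hyl, hy n n.lt_succ_self] at hm
    rw [map_measureReal_apply hZ (measurableSet_singleton _), hm]
    rfl
  have hprob : IsProbabilityMeasure (μ.map Z) := Measure.isProbabilityMeasure_map hZ.aemeasurable
  calc ∫ ω, G (fun k => X k ω) * h (X n ω) (X (n + 1) ω) ∂μ = ∫ z, F z ∂(μ.map Z) := by
        rw [integral_map hZ.aemeasurable (Measurable.of_discrete).aestronglyMeasurable]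
        rfl
    _ = ∑ z, (μ.map Z).real {z} * F z := by
        rw [integral_fintype .of_finite]
        rfl
    _ = ∑ x : Fin (n + 1) → S, μ.real {ω | ∀ k : Fin (n + 1), X k ω = x k} * G x *
          ∑ j, P (x (Fin.last n)) j * h (x (Fin.last n)) j := by
        rw [Fintype.sum_prod_type]
        refine Finset.sum_congr rfl fun x _ => ?_
        rw [Finset.mul_sum]
        refine Finset.sum_congr rfl fun j _ => ?_
        rw [hmarkov]
        ring
    _ = 0 := by simp [hh]

/-- The strong law of large numbers for functions of the transitions with vanishing conditional
mean. -/
theorem IsMarkovChain.ae_tendsto_average_zero (hX : IsMarkovChain P μ X) {h : S → S → ℝ}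
    (hh : ∀ i, ∑ j, P i j * h i j = 0) :
    ∀ᵐ ω ∂μ, Tendsto (fun n : ℕ => (∑ k ∈ Finset.range n, h (X k ω) (X (k + 1) ω)) / n)
      atTop (𝓝 0) := by
  have hbdd : ∀ i j, |h i j| ≤ ∑ p : S × S, |h p.1 p.2| := fun i j =>
    Finset.single_le_sum (f := fun p : S × S => |h p.1 p.2|) (fun p _ => abs_nonneg _)
      (Finset.mem_univ (i, j))
  refine ae_tendsto_average_zero_of_orthogonal (fun n => ?_) (fun n ω => hbdd _ _)
    fun m n hmn => ?_
  · exact (Measurable.of_discrete (f := fun p : S × S => h p.1 p.2)).comp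
      ((hX.measurable n).prodMk (hX.measurable (n + 1)))
  -- As `m + 1 ≤ n`, the earlier increment is a function of `X 0, …, X n`.
  · exact hX.integral_mul_eq_zero hh n
      fun x => h (x ⟨m, by omega⟩) (x ⟨m + 1, by omega⟩)

theorem IsMarkovChain.ae_tendsto_cumulativePayoff (hX : IsMarkovChain P μ X)
    (hP : P ∈ Matrix.rowStochastic ℝ S) (hirr : P.IsIrreducible) {π : S → ℝ}
    (hπ : IsStationary P π) (W : Matrix S S ℝ) :
    ∀ᵐ ω ∂μ, Tendsto (fun n : ℕ => (n : ℝ)⁻¹ * cumulativePayoff W X n ω) atTop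
      (𝓝 (meanPayoff P W π)) := by
  obtain ⟨g, hg⟩ := exists_poisson_solution hP hirr hπ ((P ⊙ W) *ᵥ 1)
  change ∀ i, _ - meanPayoff P W π = _ at hg
  set m := meanPayoff P W π
  let h : S → S → ℝ := fun i j => W i j - m + g j - g i
  have hh : ∀ i, ∑ j, P i j * h i j = 0 := by
    intro i
    have h1 := hg i
    have h2 : ((P ⊙ W) *ᵥ 1) i = ∑ j, P i j * W i j := by
      simp [Matrix.mulVec, dotProduct]
    have h3 : (P *ᵥ g) i = ∑ j, P i j * g j := rfl
    simp only [h, mul_sub, mul_add, Finset.sum_sub_distrib, Finset.sum_add_distrib,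
      ← Finset.sum_mul, Matrix.sum_row_of_mem_rowStochastic hP]
    linarith
  filter_upwards [hX.ae_tendsto_average_zero hh] with ω hω
  have hdecomp : ∀ n : ℕ, cumulativePayoff W X n ω =
      ∑ k ∈ Finset.range n, h (X k ω) (X (k + 1) ω) + n * m - (g (X n ω) - g (X 0 ω)) := by
    intro n
    rw [← Finset.sum_range_sub (fun k => g (X k ω))]
    simp only [cumulativePayoff, h, Finset.sum_sub_distrib, Finset.sum_add_distrib,
      Finset.sum_const, Finset.card_range, nsmul_eq_mul]
    ring
  have hboundary : Tendsto (fun n : ℕ => (g (X n ω) - g (X 0 ω)) / n) atTop (𝓝 0) := by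
    obtain ⟨B, hB⟩ := (Set.finite_range fun i => g i - g (X 0 ω)).bddAbove
    obtain ⟨b, hb⟩ := (Set.finite_range fun i => g i - g (X 0 ω)).bddBelow
    exact tendsto_bdd_div_atTop_nhds_zero (Eventually.of_forall fun n => hb ⟨X n ω, rfl⟩)
      (Eventually.of_forall fun n => hB ⟨X n ω, rfl⟩) tendsto_natCast_atTop_atTop
  have hlim := (hω.add_const m).sub hboundary
  rw [zero_add, sub_zero] at hlim
  refine hlim.congr' ?_
  filter_upwards [eventually_ne_atTop 0] with n hn
  have : (n : ℝ) ≠ 0 := Nat.cast_ne_zero.2 hn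
  rw [hdecomp]
  field_simp

end Chain

end FiniteMarkov

theorem theorem8 {S : Type*} [Fintype S] [DecidableEq S] [Nonempty S] [MeasurableSpace S]
    [MeasurableSingletonClass S] (P : Matrix S S ℝ) (hP : P ∈ Matrix.rowStochastic ℝ S)
    (hirr : P.IsIrreducible) (hper : FiniteMarkov.HasPeriod P 2) :
    (∃! π : S → ℝ, FiniteMarkov.IsStationary P π) ∧
    ∀ (π : S → ℝ), FiniteMarkov.IsStationary P π →
      ∀ (W : Matrix S S ℝ) {Ω : Type*} [MeasurableSpace Ω] (μ : Measure Ω)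
        [IsProbabilityMeasure μ] (X : ℕ → Ω → S), FiniteMarkov.IsMarkovChain P μ X →
        ∀ᵐ ω ∂μ, Tendsto (fun n : ℕ => (n : ℝ)⁻¹ * FiniteMarkov.cumulativePayoff W X n ω)
          atTop (𝓝 (FiniteMarkov.meanPayoff P W π)) := by
  obtain ⟨π, hπ⟩ := FiniteMarkov.exists_isStationary hP
  refine ⟨⟨π, hπ, fun ρ hρ => FiniteMarkov.IsStationary.unique hP hirr hπ hρ⟩, ?_⟩
  intro π hπ W Ω _ μ _ X hX
  exact hX.ae_tendsto_cumulativePayoff hP hirr hπ W
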